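/- Let $d\geq 1$ be an integer, $\alpha>0$, $\delta=d/\alpha$, $s>0$, and $c_d=\pi^{d/2}/\Gamma(1+d/2)$. Let $y_1,y_2,\dots$ be the points of a stationary Poisson point process of intensity $1$ in $\mathbb{R}^d$, ordered by their distance to the origin, and let $x_i=\|y_i\|^\alpha$. Let $f_i^{(k)}$ ($i,k\geq 1$) be iid random variables with values in $[0,\infty)$, distribution function $F(t)=\mathbb{P}[f_i^{(k)}\leq t]$ and mean $1$, independent of the points $y_i$ (iid block fading: $f_i^{(k)}$ is the fading coefficient of node $i$ during the $k$-th transmission). Node $i$ receives the $k$-th transmission if $x_i/f_i^{(k)}<1/s$, where $x/0=\infty$ for $x>0$. For every integer $n\geq 0$, consider the point process $$\hat\Phi^n=\{x_i:\ x_i/f_i^{(k)}<1/s\text{ for some }k\in\{1,\dots,n\}\}$$ of the nodes that receive at least one of the first $n$ transmissions, and let $\hat N^n$ be the number of its points. Then $\hat\Phi^n$ has the density $$\hat\lambda^n(x)=(1-F(sx)^n)\,c_d\,\delta\,x^{\delta-1},\qquad x>0,$$ that is, $\mathbb{E}\,\hat\Phi^n(B)=\int_B\hat\lambda^n(x)\,dx$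 for every Borel set $B\subset(0,\infty)$, and $\mathbb{E}\,\hat\Phi^n(\{0\})=0$. In the standard network, that is, if $\delta=1$ and $F(t)=1-e^{-t}$ for $t\geq 0$, $F(t)=0$ for $t<0$, moreover $$\mathbb{E}\hat N^n=\int_0^\infty\hat\lambda^n(x)\,dx=\frac{c_d}{s}\bigl(\Psi(n+1)+\gamma\bigr)<\infty$$ for every $n\geq 0$, where $\Psi=\Gamma'/\Gamma$ is the digamma function and $\gamma$ is Euler's constant, and $\mathbb{E}\hat N^n$ grows logarithmically: $\mathbb{E}\hat N^n\sim\frac{c_d}{s}\log n$ as $n\to\infty$. -/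

import Mathlib

open MeasureTheory ProbabilityTheory Filter Asymptotics Set
open scoped ENNReal NNReal

namespace RandomNetwork

noncomputable section

/-- The volume `c_d = π^(d/2) / Γ(1 + d/2)` of the unit ball of `ℝ^d`. -/
def unitBallVolume (d : ℕ) : ℝ :=
  Real.pi ^ ((d : ℝ) / 2) / Real.Gamma (1 + (d : ℝ) / 2)

/-- The counting measure `B ↦ #{i ∈ A : z i ∈ B}` of the points `z i` with index in `A`. -/
def pointMeasure {E : Type*} [MeasurableSpace E] (z : ℕ → E) (A : Set ℕ) : Measure E :=
  Measure.sum fun i : A => Measure.dirac (z i)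

/-- The random counting measure `Φ` is a Poisson point process with intensity measure `Λ`:
the number of points in a measurable set of finite intensity is Poisson distributed with the
intensity of the set as its mean, and the numbers of points in finitely many pairwise disjoint
measurable sets are independent. -/
structure IsPoissonProcess {Ω E : Type*} [MeasurableSpace Ω] [MeasurableSpace E]
    (P : Measure Ω) (Φ : Ω → Measure E) (Λ : Measure E) : Prop where
  law_count : ∀ B : Set E, MeasurableSet B → Λ B ≠ ∞ →
    HasLaw (fun ω => Φ ω B)
      ((poissonMeasure (Λ B).toNNReal).map (fun k : ℕ => (k : ℝ≥0∞))) P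
  indep_count : ∀ (m : ℕ) (B : Fin m → Set E), (∀ j, MeasurableSet (B j)) →
    Pairwise (fun j l => Disjoint (B j) (B l)) → iIndepFun (fun j ω => Φ ω (B j)) P

/-- A network with iid block fading. The nodes `y 0, y 1, …` are the points of a stationary
Poisson point process of intensity `1` in `ℝ^d`, ordered by their distance to the origin, and
`f k i` is the (power) fading coefficient of node `i` during transmission `k`. The fading
coefficients are iid over transmissions and nodes, independent of the nodes, and have law `ν`, a
distribution on `[0, ∞)` with mean `1`. -/
structure IsBlockFadingNetwork {Ω : Type*} [MeasurableSpace Ω] (P : Measure Ω) (d : ℕ)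
    (ν : Measure ℝ) (y : ℕ → Ω → EuclideanSpace ℝ (Fin d)) (f : ℕ → ℕ → Ω → ℝ) : Prop where
  measurable_node : ∀ i, Measurable (y i)
  poisson : IsPoissonProcess P (fun ω => pointMeasure (fun i => y i ω) univ) volume
  ordered : ∀ᵐ ω ∂P, Monotone fun i => ‖y i ω‖
  measurable_fading : ∀ k i, Measurable (f k i)
  law_fading : ∀ k i, HasLaw (f k i) ν P
  indep_fading : iIndepFun (fun p : ℕ × ℕ => f p.1 p.2) P
  indep_node_fading :
    IndepFun (fun ω (i : ℕ) => y i ω) (fun ω (p : ℕ × ℕ) => f p.1 p.2 ω) P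
  fading_nonneg : ∀ᵐ t ∂ν, 0 ≤ t
  fading_mean : ∫ t, t ∂ν = 1

section

variable {Ω : Type*} {d : ℕ}

/-- The path loss `x i = ‖y i‖ ^ α` of node `i` before fading, for the path loss exponent `α`. -/
def pathLoss (α : ℝ) (y : ℕ → Ω → EuclideanSpace ℝ (Fin d)) (i : ℕ) (ω : Ω) : ℝ :=
  ‖y i ω‖ ^ α

/-- The path loss `ξ = x i / f k i` of node `i` with the fading of transmission `k`. It is an
extended number: a positive path loss becomes infinite when the fading coefficient is `0`. -/
def fadedPathLoss (α : ℝ) (y : ℕ → Ω → EuclideanSpace ℝ (Fin d)) (f : ℕ → ℕ → Ω → ℝ)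
    (k i : ℕ) (ω : Ω) : ℝ≥0∞ :=
  ENNReal.ofReal (pathLoss α y i ω) / ENNReal.ofReal (f k i ω)

/-- The nodes that receive at least one of the first `n` transmissions. A node receives a
transmission if its path loss with fading is smaller than `1 / s`. -/
def reachedNodes (α s : ℝ) (y : ℕ → Ω → EuclideanSpace ℝ (Fin d)) (f : ℕ → ℕ → Ω → ℝ)
    (n : ℕ) (ω : Ω) : Set ℕ :=
  {i | ∃ k < n, fadedPathLoss α y f k i ω < ENNReal.ofReal (1 / s)}

/-- The point process on the half-line of the path losses (before fading) of the nodes that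
receive at least one of the first `n` transmissions, as a random counting measure. -/
def reachedProcess (α s : ℝ) (y : ℕ → Ω → EuclideanSpace ℝ (Fin d)) (f : ℕ → ℕ → Ω → ℝ)
    (n : ℕ) (ω : Ω) : Measure ℝ :=
  pointMeasure (fun i => pathLoss α y i ω) (reachedNodes α s y f n ω)

/-- The number of nodes that receive at least one of the first `n` transmissions. -/
def reachedNumber (α s : ℝ) (y : ℕ → Ω → EuclideanSpace ℝ (Fin d)) (f : ℕ → ℕ → Ω → ℝ)
    (n : ℕ) (ω : Ω) : ℝ≥0∞ :=
  reachedProcess α s y f n ω (Ici 0)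

end

/-- The point process `Φ`, all of whose points are in the half-line `[0, ∞)`, has the density
`lam` on the half-line: the expected number of points in `B` is the integral of `lam` over the
positive part of `B`. -/
def HasPointDensity {Ω : Type*} [MeasurableSpace Ω] (P : Measure Ω) (Φ : Ω → Measure ℝ)
    (lam : ℝ → ℝ) : Prop :=
  ∀ B : Set ℝ, MeasurableSet B →
    AEMeasurable (fun ω => Φ ω B) P ∧
      ∫⁻ ω, Φ ω B ∂P = ∫⁻ x in B ∩ Ioi 0, ENNReal.ofReal (lam x)

/-- The density `(1 - F(s x)^n) c_d δ x^(δ-1)`, where `F` is the cumulative distribution function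
of `ν`. -/
def reachedDensity (d : ℕ) (δ s : ℝ) (ν : Measure ℝ) (n : ℕ) (x : ℝ) : ℝ :=
  (1 - cdf ν (s * x) ^ n) * (unitBallVolume d * δ * x ^ (δ - 1))

/-- The parameters of the standard network: the path loss exponent is the dimension, i.e.
`δ = d / α = 1`, and the fading is Rayleigh fading, i.e. `F(x) = 1 - exp (-x)` for `x ≥ 0` and
`F(x) = 0` for `x < 0`. -/
def IsStandard (d : ℕ) (α : ℝ) (ν : Measure ℝ) : Prop :=
  (d : ℝ) / α = 1 ∧ ∀ x : ℝ, cdf ν x = if 0 ≤ x then 1 - Real.exp (-x) else 0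

end

end RandomNetwork

/-! ### Poisson means and the image of Lebesgue measure under the path loss -/

namespace RandomNetwork

open Topology

/-! Only expectations matter, so no thinning theorem is needed. By Campbell's formula
(`IsPoissonProcess.sum_map_eq`) the laws of the nodes sum to Lebesgue measure. Given a node at path
loss `x > 0`, independence of the fading makes all `n` transmissions fail with probability `F(s
x)^n` (`measure_reached_and_mem`). Summing over nodes integrates `1 - F(s x)^n` against the image of
Lebesgue measure under `‖v‖ ^ α`, whose distribution function is `c_d b^δ` on `b ≥ 0`. In the
standard network, `1 - (1 - e^(-s x))^n` is a geometric sum whose terms integrate to `1 / (s (k +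
1))`. The mean is therefore `c_d H_n / s`, with `H_n = Ψ(n + 1) + γ ~ log n`. -/

theorem lintegral_natCast_poissonMeasure (r : ℝ≥0) :
    ∫⁻ k, (k : ℝ≥0∞) ∂(poissonMeasure r) = r := by
  have hstep (k : ℕ) : ((k + 1 : ℕ) : ℝ≥0∞) * poissonMeasure r {k + 1}
      = r * poissonMeasure r {k} := by
    rw [poissonMeasure_singleton, poissonMeasure_singleton, ← ENNReal.ofReal_natCast,
      ← ENNReal.ofReal_coe_nnreal, ← ENNReal.ofReal_mul (by positivity),
      ← ENNReal.ofReal_mul (by positivity), Nat.factorial_succ]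
    congr 1
    push_cast
    field_simp
    ring
  rw [lintegral_countable', tsum_eq_zero_add' ENNReal.summable]
  simp_rw [hstep, ENNReal.tsum_mul_left]
  have h := lintegral_countable' (μ := poissonMeasure r) (fun _ => 1)
  simp only [lintegral_const, measure_univ, one_mul] at h
  simp [← h]

/-- The measures may have infinite total mass; finiteness on each `Iic b` suffices to subtract and
recover the masses of the intervals `Ioc a b`. -/
theorem measure_ext_of_Iic_ne_top {μ μ' : Measure ℝ} (hμ : ∀ b, μ (Iic b) ≠ ∞)
    (h : ∀ b, μ (Iic b) = μ' (Iic b)) : μ = μ' := by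
  refine Measure.ext_of_Ioc' μ μ'
    (fun a b _ => ne_top_of_le_ne_top (hμ b) (measure_mono Ioc_subset_Iic_self)) fun a b hab => ?_
  rw [← Iic_sdiff_Iic, measure_sdiff (Iic_subset_Iic.2 hab.le) nullMeasurableSet_Iic (hμ a),
    measure_sdiff (Iic_subset_Iic.2 hab.le) nullMeasurableSet_Iic (h a ▸ hμ a), h a, h b]

theorem unitBallVolume_pos (d : ℕ) : 0 < unitBallVolume d := by
  unfold unitBallVolume
  have : 0 < Real.Gamma (1 + (d : ℝ) / 2) := Real.Gamma_pos_of_pos (by positivity)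
  positivity

theorem volume_norm_rpow_le {d : ℕ} (hd : 0 < d) {α : ℝ} (hα : 0 < α) (b : ℝ) :
    volume {v : EuclideanSpace ℝ (Fin d) | ‖v‖ ^ α ≤ b} =
      ENNReal.ofReal (unitBallVolume d * max b 0 ^ ((d : ℝ) / α)) := by
  have : Nonempty (Fin d) := ⟨⟨0, hd⟩⟩
  rcases lt_or_ge b 0 with hb | hb
  · have : {v : EuclideanSpace ℝ (Fin d) | ‖v‖ ^ α ≤ b} = ∅ := by
      ext v
      simpa using hb.trans_le (Real.rpow_nonneg (norm_nonneg v) α)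
    rw [this, max_eq_right hb.le, Real.zero_rpow (by positivity)]
    simp
  · have : {v : EuclideanSpace ℝ (Fin d) | ‖v‖ ^ α ≤ b} = Metric.closedBall 0 (b ^ (1 / α)) := by
      ext v
      simp only [mem_ofPred_eq, mem_closedBall_zero_iff, one_div]
      exact Real.le_rpow_inv_iff_of_pos (norm_nonneg v) hb hα |>.symm
    rw [this, EuclideanSpace.volume_closedBall, Fintype.card_fin, max_eq_left hb,
      ← ENNReal.ofReal_pow (by positivity), ← ENNReal.ofReal_mul (by positivity), mul_comm]
    congr 2
    · rw [unitBallVolume, add_comm (1 : ℝ), Real.sqrt_eq_rpow, ← Real.rpow_natCast,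
        ← Real.rpow_mul Real.pi_pos.le]
      congr 2
      ring
    · rw [← Real.rpow_natCast, ← Real.rpow_mul hb]
      congr 1
      ring

theorem setLIntegral_rpow_density {c δ : ℝ} (hc : 0 ≤ c) (hδ : 0 < δ) (b : ℝ) :
    ∫⁻ x in Iic b ∩ Ioi 0, ENNReal.ofReal (c * δ * x ^ (δ - 1)) =
      ENNReal.ofReal (c * max b 0 ^ δ) := by
  rw [inter_comm, Ioi_inter_Iic]
  rcases le_or_gt b 0 with hb | hb
  · rw [Ioc_eq_empty (not_lt.2 hb), max_eq_right hb, Real.zero_rpow hδ.ne']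
    simp
  · have hint : IntervalIntegrable (fun x : ℝ => c * δ * x ^ (δ - 1)) volume 0 b :=
      (intervalIntegral.intervalIntegrable_rpow' (by linarith)).const_mul _
    rw [← ofReal_integral_eq_lintegral_ofReal
      ((intervalIntegrable_iff_integrableOn_Ioc_of_le hb.le).1 hint),
      ← intervalIntegral.integral_of_le hb.le, intervalIntegral.integral_const_mul,
      integral_rpow (Or.inl (by linarith)), max_eq_left hb.le]
    · congr 1
      simp only [sub_add_cancel, Real.zero_rpow hδ.ne']
      field_simp
      simp
    · filter_upwards [ae_restrict_mem measurableSet_Ioc] with x hx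
      have := hx.1
      simp only [Pi.zero_apply]
      positivity

/-- Path losses of the unit intensity Lebesgue measure have intensity `c_d δ x^(δ-1)`. -/
theorem map_norm_rpow_volume {d : ℕ} (hd : 0 < d) {α : ℝ} (hα : 0 < α) :
    (volume : Measure (EuclideanSpace ℝ (Fin d))).map (fun v => ‖v‖ ^ α) =
      (volume.restrict (Ioi 0)).withDensity fun x =>
        ENNReal.ofReal (unitBallVolume d * ((d : ℝ) / α) * x ^ ((d : ℝ) / α - 1)) := by
  have hmap (b : ℝ) : (volume : Measure (EuclideanSpace ℝ (Fin d))).map (fun v => ‖v‖ ^ α) (Iic b)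
      = ENNReal.ofReal (unitBallVolume d * max b 0 ^ ((d : ℝ) / α)) := by
    rw [Measure.map_apply (by fun_prop) measurableSet_Iic]
    exact volume_norm_rpow_le hd hα b
  refine measure_ext_of_Iic_ne_top (fun b => by simp [hmap]) fun b => ?_
  rw [hmap, withDensity_apply _ measurableSet_Iic, Measure.restrict_restrict measurableSet_Iic,
    setLIntegral_rpow_density (unitBallVolume_pos d).le (by positivity)]

/-! ### Counting measures and their intensity -/

section PointMeasure

variable {E : Type*} [MeasurableSpace E]

theorem pointMeasure_apply {z : ℕ → E} {A : Set ℕ} {B : Set E} (hB : MeasurableSet B) :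
    pointMeasure z A B = ∑' i, {i | i ∈ A ∧ z i ∈ B}.indicator 1 i := by
  rw [pointMeasure, Measure.sum_apply _ hB, tsum_subtype A fun i => Measure.dirac (z i) B]
  refine tsum_congr fun i => ?_
  by_cases h : i ∈ A <;> by_cases h' : z i ∈ B <;> simp [h, h', hB]

theorem pointMeasure_apply_eq_tsum_indicator {Ω : Type*} {z : ℕ → Ω → E} {A : Ω → Set ℕ} {B : Set E}
    (hB : MeasurableSet B) :
    (fun ω => pointMeasure (fun i => z i ω) (A ω) B) =
      fun ω => ∑' i, {ω | i ∈ A ω ∧ z i ω ∈ B}.indicator 1 ω := by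
  ext ω
  rw [pointMeasure_apply hB]
  rfl

variable {Ω : Type*} [MeasurableSpace Ω]

theorem measurable_pointMeasure_apply {z : ℕ → Ω → E} {A : Ω → Set ℕ} {B : Set E}
    (hB : MeasurableSet B) (h : ∀ i, MeasurableSet {ω | i ∈ A ω ∧ z i ω ∈ B}) :
    Measurable fun ω => pointMeasure (fun i => z i ω) (A ω) B := by
  rw [pointMeasure_apply_eq_tsum_indicator hB]
  exact Measurable.tsum fun i => measurable_one.indicator (h i)

theorem lintegral_pointMeasure_apply (P : Measure Ω) {z : ℕ → Ω → E} {A : Ω → Set ℕ} {B : Set E}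
    (hB : MeasurableSet B) (h : ∀ i, MeasurableSet {ω | i ∈ A ω ∧ z i ω ∈ B}) :
    ∫⁻ ω, pointMeasure (fun i => z i ω) (A ω) B ∂P = ∑' i, P {ω | i ∈ A ω ∧ z i ω ∈ B} := by
  rw [pointMeasure_apply_eq_tsum_indicator hB,
    lintegral_tsum fun i => (measurable_one.indicator (h i)).aemeasurable]
  exact tsum_congr fun i => lintegral_indicator_one (h i)

theorem IsPoissonProcess.lintegral_apply {P : Measure Ω} {Φ : Ω → Measure E} {Λ : Measure E}
    (hΦ : IsPoissonProcess P Φ Λ) {B : Set E} (hB : MeasurableSet B) (hΛ : Λ B ≠ ∞) :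
    ∫⁻ ω, Φ ω B ∂P = Λ B := by
  have h := (hΦ.law_count B hB hΛ).lintegral_comp (f := id) aemeasurable_id
  simp only [id] at h
  rw [h, lintegral_map (by fun_prop) (by fun_prop), lintegral_natCast_poissonMeasure,
    ENNReal.coe_toNNReal hΛ]

/-- Campbell's formula: the laws of the points of a Poisson process sum up to its intensity. -/
theorem IsPoissonProcess.sum_map_eq {P : Measure Ω} {z : ℕ → Ω → E} {Λ : Measure E} [SigmaFinite Λ]
    (hz : ∀ i, Measurable (z i))
    (hΦ : IsPoissonProcess P (fun ω => pointMeasure (fun i => z i ω) univ) Λ) :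
    Measure.sum (fun i => P.map (z i)) = Λ := by
  -- The Poisson law of the count is given only for sets of finite intensity, hence the localization
  -- to spanning sets.
  refine Measure.ext_of_iUnion_eq_univ (iUnion_spanningSets Λ) fun k => ?_
  ext B hB
  rw [Measure.restrict_apply hB, Measure.restrict_apply hB]
  have hB' := hB.inter (measurableSet_spanningSets Λ k)
  have hfin : Λ (B ∩ spanningSets Λ k) ≠ ∞ :=
    ne_top_of_le_ne_top (measure_spanningSets_lt_top Λ k).ne (measure_mono inter_subset_right)
  rw [← hΦ.lintegral_apply hB' hfin, lintegral_pointMeasure_apply P hB'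
    (fun i => by simp only [mem_univ, true_and]; exact hz i hB'), Measure.sum_apply _ hB']
  refine tsum_congr fun i => ?_
  rw [Measure.map_apply (hz i) hB']
  simp [preimage]

end PointMeasure

/-! ### Reception under block fading -/

section Reception

variable {Ω : Type*} {d : ℕ} {α s : ℝ} {y : ℕ → Ω → EuclideanSpace ℝ (Fin d)}
  {f : ℕ → ℕ → Ω → ℝ}

/-- Positivity of `x` is essential: in `ℝ≥0∞`, `0 / 0 = 0`, so a node at the origin would receive
even with zero fading. -/
theorem ofReal_div_ofReal_lt_iff {x t : ℝ} (hs : 0 < s) (hx : 0 < x) :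
    ENNReal.ofReal x / ENNReal.ofReal t < ENNReal.ofReal (1 / s) ↔ s * x < t := by
  rcases le_or_gt t 0 with ht | ht
  · have hsx := mul_pos hs hx
    rw [ENNReal.ofReal_of_nonpos ht, ENNReal.div_zero (by simpa using hx)]
    simp only [not_top_lt, false_iff, not_lt]
    linarith
  · rw [← ENNReal.ofReal_div_of_pos ht, ENNReal.ofReal_lt_ofReal_iff (by positivity),
      div_lt_div_iff₀ ht hs, one_mul, mul_comm]

theorem mem_reachedNodes_iff (hs : 0 < s) {n i : ℕ} {ω : Ω} (h : y i ω ≠ 0) :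
    i ∈ reachedNodes α s y f n ω ↔ ∃ k < n, s * ‖y i ω‖ ^ α < f k i ω := by
  have hpos : 0 < ‖y i ω‖ ^ α := Real.rpow_pos_of_pos (norm_pos_iff.2 h) α
  simp only [reachedNodes, fadedPathLoss, pathLoss, mem_ofPred_eq,
    ofReal_div_ofReal_lt_iff hs hpos]

variable [MeasurableSpace Ω]

theorem measurableSet_mem_reachedNodes (hy : ∀ i, Measurable (y i))
    (hf : ∀ k i, Measurable (f k i)) (n i : ℕ) {B : Set ℝ} (hB : MeasurableSet B) :
    MeasurableSet {ω | i ∈ reachedNodes α s y f n ω ∧ pathLoss α y i ω ∈ B} := by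
  have hx : Measurable (pathLoss α y i) := (hy i).norm.pow_const α
  have hset (k : ℕ) :
      MeasurableSet {ω | fadedPathLoss α y f k i ω < ENNReal.ofReal (1 / s)} :=
    measurableSet_lt (hx.ennreal_ofReal.div (hf k i).ennreal_ofReal) measurable_const
  have heq : {ω | i ∈ reachedNodes α s y f n ω ∧ pathLoss α y i ω ∈ B} =
      (⋃ k, ⋃ _ : k < n, {ω | fadedPathLoss α y f k i ω < ENNReal.ofReal (1 / s)}) ∩
        pathLoss α y i ⁻¹' B := by
    ext ω
    simp [reachedNodes]
  rw [heq]
  exact (MeasurableSet.iUnion fun k => MeasurableSet.iUnion fun _ => hset k).inter (hx hB)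

variable {P : Measure Ω} {ν : Measure ℝ}

theorem IsBlockFadingNetwork.ae_node_ne_zero (hnet : IsBlockFadingNetwork P d ν y f) (hd : 0 < d) (i : ℕ) :
    ∀ᵐ ω ∂P, y i ω ≠ 0 := by
  have : Nonempty (Fin d) := ⟨⟨0, hd⟩⟩
  have hsum := hnet.poisson.sum_map_eq hnet.measurable_node
  have h0 : Measure.sum (fun i => P.map (y i)) {0} = 0 := by rw [hsum]; simp
  rw [Measure.sum_apply _ (measurableSet_singleton 0), ENNReal.tsum_eq_zero] at h0
  have hi := h0 i
  rw [Measure.map_apply (hnet.measurable_node i) (measurableSet_singleton 0)] at hi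
  rw [ae_iff]
  convert hi using 2
  ext ω
  simp

variable [IsProbabilityMeasure P] [IsProbabilityMeasure ν]

/-- The probability that one of `n` independent variables of law `ν` exceeds `t`. -/
theorem measure_exists_lt_eq {X : ℕ → Ω → ℝ} (hX : ∀ k, Measurable (X k))
    (hlaw : ∀ k, HasLaw (X k) ν P) (hindep : iIndepFun X P) (n : ℕ) (t : ℝ) :
    P {ω | ∃ k < n, t < X k ω} = ENNReal.ofReal (1 - cdf ν t ^ n) := by
  have hcompl : {ω | ∃ k < n, t < X k ω} = (⋂ k ∈ Finset.range n, X k ⁻¹' Iic t)ᶜ := by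
    ext ω
    simp
  have hmeas : MeasurableSet (⋂ k ∈ Finset.range n, X k ⁻¹' Iic t) :=
    Finset.measurableSet_biInter _ fun k _ => hX k measurableSet_Iic
  have hprob (k : ℕ) : P (X k ⁻¹' Iic t) = ENNReal.ofReal (cdf ν t) := by
    rw [← Measure.map_apply (hX k) measurableSet_Iic, (hlaw k).map_eq, ofReal_cdf]
  rw [hcompl, prob_compl_eq_one_sub hmeas,
    hindep.measure_inter_preimage_eq_mul (Finset.range n) fun _ _ => measurableSet_Iic]
  simp only [hprob, Finset.prod_const, Finset.card_range]
  rw [← ENNReal.ofReal_pow (cdf_nonneg ν t), ← ENNReal.ofReal_one,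
    ← ENNReal.ofReal_sub _ (pow_nonneg (cdf_nonneg ν t) n)]

namespace IsBlockFadingNetwork

theorem measure_reached_and_mem (hnet : IsBlockFadingNetwork P d ν y f) (hd : 0 < d)
    (hs : 0 < s) (n i : ℕ) {B : Set ℝ} (hB : MeasurableSet B) :
    P {ω | i ∈ reachedNodes α s y f n ω ∧ pathLoss α y i ω ∈ B} =
      ∫⁻ v, B.indicator (fun x => ENNReal.ofReal (1 - cdf ν (s * x) ^ n)) (‖v‖ ^ α)
        ∂(P.map (y i)) := by
  have hy := hnet.measurable_node i
  set g : Ω → ℕ → ℝ := fun ω k => f k i ω with hgdef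
  have hg : Measurable g := measurable_pi_lambda _ fun k => hnet.measurable_fading k i
  have hindep : IndepFun (y i) g P :=
    hnet.indep_node_fading.comp (φ := fun v : ℕ → EuclideanSpace ℝ (Fin d) => v i)
      (ψ := fun (h : ℕ × ℕ → ℝ) k => h (k, i)) (measurable_pi_apply i)
      (measurable_pi_lambda _ fun k => measurable_pi_apply (k, i))
  set S : Set (EuclideanSpace ℝ (Fin d) × (ℕ → ℝ)) :=
    (⋃ k, ⋃ _ : k < n, {p | s * ‖p.1‖ ^ α < p.2 k}) ∩ (fun p => ‖p.1‖ ^ α) ⁻¹' B with hSdef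
  have hpow : Measurable fun p : EuclideanSpace ℝ (Fin d) × (ℕ → ℝ) => ‖p.1‖ ^ α := by fun_prop
  have hS : MeasurableSet S :=
    (MeasurableSet.iUnion fun k => MeasurableSet.iUnion fun _ =>
      measurableSet_lt (hpow.const_mul s) (by fun_prop)).inter (hpow hB)
  -- The two events can differ only when the node sits at the origin, which is a null event.
  have hae : ({ω | i ∈ reachedNodes α s y f n ω ∧ pathLoss α y i ω ∈ B} : Set Ω) =ᵐ[P]
      (fun ω => (y i ω, g ω)) ⁻¹' S := by
    filter_upwards [hnet.ae_node_ne_zero hd i] with ω hω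
    have := mem_reachedNodes_iff (α := α) (f := f) (n := n) hs hω
    apply propext
    change (_ ∧ _) ↔ (y i ω, g ω) ∈ S
    rw [this]
    simp [hSdef, hgdef, pathLoss]
  -- The joint law of a node and its fading sequence is a product; Tonelli reduces the claim to
  -- sections at a fixed position `v`.
  rw [measure_congr hae, ← Measure.map_apply (hy.prodMk hg) hS,
    (indepFun_iff_map_prod_eq_prod_map_map hy.aemeasurable hg.aemeasurable).1 hindep,
    Measure.prod_apply hS]
  refine lintegral_congr fun v => ?_
  have hsec : MeasurableSet (Prod.mk v ⁻¹' S) := measurable_prodMk_left hS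
  rw [Measure.map_apply hg hsec]
  by_cases hv : ‖v‖ ^ α ∈ B
  · rw [indicator_of_mem hv, ← measure_exists_lt_eq (X := fun k => f k i)
      (fun k => hnet.measurable_fading k i) (fun k => hnet.law_fading k i)
      (hnet.indep_fading.precomp (g := fun k => (k, i)) fun a b h => (Prod.mk.inj h).1)]
    congr 1
    ext ω
    simp [hSdef, hgdef, hv]
  · rw [indicator_of_notMem hv]
    convert measure_empty (μ := P)
    ext ω
    simp [hSdef, hv]

theorem hasPointDensity (hnet : IsBlockFadingNetwork P d ν y f) (hd : 0 < d)
    (hα : 0 < α) (hs : 0 < s) (n : ℕ) :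
    HasPointDensity P (reachedProcess α s y f n) (reachedDensity d ((d : ℝ) / α) s ν n) := by
  intro B hB
  have hmeas (i : ℕ) := measurableSet_mem_reachedNodes (α := α) (s := s) hnet.measurable_node
    hnet.measurable_fading n i hB
  refine ⟨(measurable_pointMeasure_apply hB hmeas).aemeasurable, ?_⟩
  have hcdf : Measurable fun x => ENNReal.ofReal (1 - cdf ν (s * x) ^ n) := by
    have := (cdf ν).mono.measurable
    fun_prop
  have hcdf' := hcdf.indicator hB
  have hrpow : Measurable fun v : EuclideanSpace ℝ (Fin d) => ‖v‖ ^ α := by fun_prop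
  calc ∫⁻ ω, reachedProcess α s y f n ω B ∂P
      = ∑' i, ∫⁻ v, B.indicator (fun x => ENNReal.ofReal (1 - cdf ν (s * x) ^ n)) (‖v‖ ^ α)
          ∂(P.map (y i)) := by
        unfold reachedProcess
        rw [lintegral_pointMeasure_apply P hB hmeas]
        exact tsum_congr fun i => hnet.measure_reached_and_mem hd hs n i hB
    _ = ∫⁻ x, B.indicator (fun x => ENNReal.ofReal (1 - cdf ν (s * x) ^ n)) x
          ∂((volume : Measure (EuclideanSpace ℝ (Fin d))).map fun v => ‖v‖ ^ α) := by
        rw [← lintegral_sum_measure, hnet.poisson.sum_map_eq hnet.measurable_node,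
          lintegral_map hcdf' hrpow]
    _ = ∫⁻ x in B ∩ Ioi 0, ENNReal.ofReal (reachedDensity d ((d : ℝ) / α) s ν n x) := by
        rw [map_norm_rpow_volume hd hα, lintegral_withDensity_eq_lintegral_mul _ (by fun_prop) hcdf',
          ← Measure.restrict_restrict hB, ← lintegral_indicator hB]
        refine lintegral_congr fun x => ?_
        by_cases hx : x ∈ B
        · have : 0 ≤ 1 - cdf ν (s * x) ^ n :=
            sub_nonneg.2 (pow_le_one₀ (cdf_nonneg ν _) (cdf_le_one ν _))
          simp only [Pi.mul_apply, indicator_of_mem hx, reachedDensity]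
          rw [mul_comm, ← ENNReal.ofReal_mul this]
        · simp [hx]

end IsBlockFadingNetwork

end Reception

/-! ### The standard network and harmonic numbers -/

/-- The exponential distribution function to the power `n` has total defect `H_n / s`. -/
theorem integral_one_sub_pow_exp {s : ℝ} (hs : 0 < s) (n : ℕ) :
    IntegrableOn (fun x : ℝ => 1 - (1 - Real.exp (-(s * x))) ^ n) (Ioi 0) ∧
      ∫ x in Ioi (0 : ℝ), (1 - (1 - Real.exp (-(s * x))) ^ n) = (harmonic n : ℝ) / s := by
  -- Antiderivatives of `e^(-s x) (1 - e^(-s x))^k`, vanishing at `0` and tending to `1 / (s (k +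
  -- 1))` at infinity.
  set g : ℕ → ℝ → ℝ := fun k x => (1 - Real.exp (-(s * x))) ^ (k + 1) / (s * (k + 1)) with hg
  have hderiv (k : ℕ) (x : ℝ) :
      HasDerivAt (g k) (Real.exp (-(s * x)) * (1 - Real.exp (-(s * x))) ^ k) x := by
    have h1 : HasDerivAt (fun x : ℝ => 1 - Real.exp (-(s * x))) (s * Real.exp (-(s * x))) x := by
      have h := (((hasDerivAt_id' x).const_mul s).fun_neg.exp).const_sub 1
      exact h.congr_deriv (by ring)
    have h2 := (h1.fun_pow (k + 1)).div_const (s * (k + 1))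
    refine h2.congr_deriv ?_
    rw [Nat.add_sub_cancel]
    push_cast
    field_simp
  have hpos (k : ℕ) (x : ℝ) (hx : x ∈ Ioi (0 : ℝ)) :
      0 ≤ Real.exp (-(s * x)) * (1 - Real.exp (-(s * x))) ^ k := by
    have : Real.exp (-(s * x)) ≤ 1 := Real.exp_le_one_iff.2 (by have := mul_pos hs hx; linarith)
    have := sub_nonneg.2 this
    positivity
  have hlim (k : ℕ) : Tendsto (g k) atTop (𝓝 (1 / (s * (k + 1)))) := by
    have h1 : Tendsto (fun x : ℝ => Real.exp (-(s * x))) atTop (𝓝 0) :=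
      Real.tendsto_exp_neg_atTop_nhds_zero.comp (tendsto_id.const_mul_atTop hs)
    have h2 := ((h1.const_sub 1).pow (k + 1)).div_const (s * (k + 1))
    simpa using h2
  have hsum (x : ℝ) : 1 - (1 - Real.exp (-(s * x))) ^ n =
      ∑ k ∈ Finset.range n, Real.exp (-(s * x)) * (1 - Real.exp (-(s * x))) ^ k := by
    have := geom_sum_mul (1 - Real.exp (-(s * x))) n
    rw [← Finset.mul_sum]
    linarith
  have hint (k : ℕ) := integrableOn_Ioi_deriv_of_nonneg' (fun x _ => hderiv k x) (hpos k) (hlim k)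
  simp_rw [hsum]
  refine ⟨integrable_finsetSum _ fun k _ => hint k, ?_⟩
  rw [integral_finsetSum _ fun k _ => hint k]
  simp_rw [fun k => integral_Ioi_of_hasDerivAt_of_nonneg' (fun x _ => hderiv k x) (hpos k) (hlim k)]
  simp only [hg, harmonic, Rat.cast_sum, Finset.sum_div]
  refine Finset.sum_congr rfl fun k _ => ?_
  push_cast
  simp
  ring

theorem logDeriv_Gamma_natCast_add_one (n : ℕ) :
    logDeriv Real.Gamma ((n : ℝ) + 1) + Real.eulerMascheroniConstant = harmonic n := by
  rw [logDeriv_apply, Real.deriv_Gamma_nat, Real.Gamma_nat_eq_factorial]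
  have : (n.factorial : ℝ) ≠ 0 := by positivity
  field_simp
  ring

/-- The difference `H_n - log n` converges, so it is bounded and negligible against `log n`. -/
theorem harmonic_isEquivalent_log :
    (fun n : ℕ => (harmonic n : ℝ)) ~[atTop] fun n : ℕ => Real.log n := by
  have h1 : (fun n : ℕ => (harmonic n : ℝ) - Real.log n) =O[atTop] fun _ => (1 : ℝ) :=
    Real.tendsto_harmonic_sub_log.isBigO_one ℝ
  have h2 : (fun _ : ℕ => (1 : ℝ)) =o[atTop] fun n : ℕ => Real.log n :=
    (isLittleO_const_left.2 <| Or.inr <| tendsto_norm_atTop_atTop.comp <|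
      Real.tendsto_log_atTop.comp tendsto_natCast_atTop_atTop)
  exact h1.trans_isLittleO h2

theorem reachedDensity_nonneg (d : ℕ) {δ : ℝ} (hδ : 0 ≤ δ) (s : ℝ) (ν : Measure ℝ) (n : ℕ) {x : ℝ}
    (hx : 0 ≤ x) : 0 ≤ reachedDensity d δ s ν n x := by
  have := (unitBallVolume_pos d).le
  have : 0 ≤ 1 - cdf ν (s * x) ^ n := sub_nonneg.2 (pow_le_one₀ (cdf_nonneg ν _) (cdf_le_one ν _))
  unfold reachedDensity
  positivity

namespace IsStandard

variable {d : ℕ} {α s : ℝ} {ν : Measure ℝ}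

theorem reachedDensity_eq (h : IsStandard d α ν) (hs : 0 < s) (n : ℕ) {x : ℝ}
    (hx : x ∈ Ioi (0 : ℝ)) :
    reachedDensity d ((d : ℝ) / α) s ν n x =
      (1 - (1 - Real.exp (-(s * x))) ^ n) * unitBallVolume d := by
  have hsx : 0 ≤ s * x := (mul_pos hs hx).le
  simp [reachedDensity, h.1, h.2, hsx]

theorem integrableOn_reachedDensity (h : IsStandard d α ν) (hs : 0 < s) (n : ℕ) :
    IntegrableOn (reachedDensity d ((d : ℝ) / α) s ν n) (Ioi 0) :=
  (integrableOn_congr_fun (fun _ hx => h.reachedDensity_eq hs n hx) measurableSet_Ioi).2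
    ((integral_one_sub_pow_exp hs n).1.mul_const _)

theorem integral_reachedDensity (h : IsStandard d α ν) (hs : 0 < s) (n : ℕ) :
    ∫ x in Ioi (0 : ℝ), reachedDensity d ((d : ℝ) / α) s ν n x =
      unitBallVolume d / s * harmonic n := by
  rw [setIntegral_congr_fun measurableSet_Ioi fun _ hx => h.reachedDensity_eq hs n hx,
    integral_mul_const, (integral_one_sub_pow_exp hs n).2]
  ring

theorem lintegral_reachedNumber {Ω : Type*} [MeasurableSpace Ω] {P : Measure Ω}
    [IsProbabilityMeasure P] [IsProbabilityMeasure ν] {y : ℕ → Ω → EuclideanSpace ℝ (Fin d)}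
    {f : ℕ → ℕ → Ω → ℝ} (h : IsStandard d α ν) (hnet : IsBlockFadingNetwork P d ν y f)
    (hd : 0 < d) (hα : 0 < α) (hs : 0 < s) (n : ℕ) :
    ∫⁻ ω, reachedNumber α s y f n ω ∂P =
      ENNReal.ofReal (∫ x in Ioi (0 : ℝ), reachedDensity d ((d : ℝ) / α) s ν n x) := by
  have hdens := (hnet.hasPointDensity hd hα hs n (Ici 0) measurableSet_Ici).2
  -- A point at `0` costs nothing: the density formula on `Ici 0` integrates over `Ioi 0` only.
  rw [inter_eq_right.2 Ioi_subset_Ici_self] at hdens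
  unfold reachedNumber
  rw [hdens, ofReal_integral_eq_lintegral_ofReal (h.integrableOn_reachedDensity hs n)]
  filter_upwards [ae_restrict_mem measurableSet_Ioi] with x hx
  exact reachedDensity_nonneg d (by positivity) s ν n (le_of_lt hx)

end IsStandard

end RandomNetwork

theorem mainTheorem12 {Ω : Type*} [MeasurableSpace Ω] (P : Measure Ω) [IsProbabilityMeasure P]
    (d : ℕ) (hd : 0 < d) (α s : ℝ) (hα : 0 < α) (hs : 0 < s)
    (ν : Measure ℝ) [IsProbabilityMeasure ν]
    (y : ℕ → Ω → EuclideanSpace ℝ (Fin d)) (f : ℕ → ℕ → Ω → ℝ)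
    (hnet : RandomNetwork.IsBlockFadingNetwork P d ν y f) :
    (∀ n : ℕ, RandomNetwork.HasPointDensity P (RandomNetwork.reachedProcess α s y f n)
      (RandomNetwork.reachedDensity d ((d : ℝ) / α) s ν n)) ∧
    (RandomNetwork.IsStandard d α ν →
      (∀ n : ℕ,
        ∫⁻ ω, RandomNetwork.reachedNumber α s y f n ω ∂P =
          ENNReal.ofReal
            (∫ x in Ioi (0 : ℝ), RandomNetwork.reachedDensity d ((d : ℝ) / α) s ν n x) ∧
        IntegrableOn (RandomNetwork.reachedDensity d ((d : ℝ) / α) s ν n) (Ioi 0) ∧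
        ∫ x in Ioi (0 : ℝ), RandomNetwork.reachedDensity d ((d : ℝ) / α) s ν n x =
          RandomNetwork.unitBallVolume d / s *
            (logDeriv Real.Gamma ((n : ℝ) + 1) + Real.eulerMascheroniConstant)) ∧
      (fun n : ℕ => (∫⁻ ω, RandomNetwork.reachedNumber α s y f n ω ∂P).toReal) ~[atTop]
        (fun n : ℕ => RandomNetwork.unitBallVolume d / s * Real.log n)) := by
  refine ⟨fun n => hnet.hasPointDensity hd hα hs n, fun hstd => ⟨fun n =>
    ⟨hstd.lintegral_reachedNumber hnet hd hα hs n, hstd.integrableOn_reachedDensity hs n, ?_⟩, ?_⟩⟩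
  · rw [hstd.integral_reachedDensity hs, RandomNetwork.logDeriv_Gamma_natCast_add_one]
  · have hmean (n : ℕ) : (∫⁻ ω, RandomNetwork.reachedNumber α s y f n ω ∂P).toReal =
        RandomNetwork.unitBallVolume d / s * harmonic n := by
      rw [hstd.lintegral_reachedNumber hnet hd hα hs, ENNReal.toReal_ofReal
        (setIntegral_nonneg measurableSet_Ioi fun x hx =>
          RandomNetwork.reachedDensity_nonneg d (by positivity) s ν n (le_of_lt hx)),
        hstd.integral_reachedDensity hs]
    simp_rw [hmean]
    exact IsEquivalent.refl.mul RandomNetwork.harmonic_isEquivalent_log
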